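/- A directed graph is regarded as a game in which two players alternately move along arcs, and a player who cannot move loses. A vertex is an $\mathcal{N}$-position if the first player (the one about to move) has a winning strategy from it, and a $\mathcal{P}$-position if the second player has one; the graph is draw-free if each of its vertices is an $\mathcal{N}$-position or a $\mathcal{P}$-position. A Galton-Watson tree is regarded as a directed graph with an arc to each child from its parent, and rooted directed graphs are considered up to isomorphism. **Theorem.** Let $T$ be a Galton-Watson tree with root $o$, whose offspring distribution $(p_n)_{n\ge 0}$ satisfies $p_0<1$ and has probability generating function $\phi(s)=\sum_{n\ge 0}p_n s^n$. Suppose that $T$ is draw-free with probability $1$, and let $P$ be the probability that $o$ is a $\mathcal{P}$-position. Condition on the event that $o$ is an $\mathcal{N}$-position, and consider the graph obtained from $T$ by removing all the $\mathcal{P}$-positions (keeping all arcs between the remaining vertices). Let $T^{(1)}$ be the connected component of $o$ in this graph. Then, under the conditional probability, $T^{(1)}$ is again a Galton-Watson tree rooted at $o$, whose offspring distribution has the probability generating function $$\phi^{(1)}(s)=\frac{1}{1-P}\Bigl[\phi\bigl(P+s(1-P)\bigr)-\phi\bigl(s(1-P)\bigr)\Bigr],\qquad s\in[0,1].$$ 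-/

import Mathlib

open MeasureTheory ProbabilityTheory
open scoped ENNReal

/-- A directed graph whose vertices are the elements of a set `verts` in an ambient type `V`,
together with a distinguished point `root`. The root is allowed not to be a vertex, so that
vertices (the root included) can be deleted. -/
structure RootedDigraph (V : Type*) where
  verts : Set V
  Adj : V → V → Prop
  root : V
  left_mem : ∀ {x y}, Adj x y → x ∈ verts
  right_mem : ∀ {x y}, Adj x y → y ∈ verts

namespace RootedDigraph

/-- The directed graph induced on the vertices that lie in `S` (all arcs between them are kept). -/
def induce {V : Type*} (G : RootedDigraph V) (S : Set V) : RootedDigraph V where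
  verts := G.verts ∩ S
  Adj x y := G.Adj x y ∧ x ∈ S ∧ y ∈ S
  root := G.root
  left_mem h := ⟨G.left_mem h.1, h.2.1⟩
  right_mem h := ⟨G.right_mem h.1, h.2.2⟩

/-- The connected component of the root, where connectedness ignores the direction of arcs. -/
def rootComponent {V : Type*} (G : RootedDigraph V) : RootedDigraph V :=
  G.induce {x | Relation.EqvGen G.Adj G.root x}

/-- Isomorphism of rooted directed graphs. -/
def IsIso {V W : Type*} (G : RootedDigraph V) (H : RootedDigraph W) : Prop :=
  ∃ e : G.verts ≃ H.verts,
    (∀ x y : G.verts, G.Adj x y ↔ H.Adj (e x) (e y)) ∧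
    ∀ x : G.verts, (x : V) = G.root ↔ (e x : W) = H.root

/-! ### The game: two players alternately move along arcs; a player who cannot move loses -/

/-- The list `[π 0, π 1, …, π n]` of the positions visited up to time `n`. -/
def history {V : Type*} (π : ℕ → V) (n : ℕ) : List V := (List.range (n + 1)).map π

/-- The first `n` moves of `π` are a legal play from `x` in which the player who moves at the times
congruent to `i` modulo `2` (`i = 0` for the first player, `i = 1` for the second player) uses the
strategy `σ`. A strategy chooses the next position from the history of the play. -/
def IsPlay {V : Type*} (G : RootedDigraph V) (i : ℕ) (σ : List V → V) (x : V)
    (π : ℕ → V) (n : ℕ) : Prop :=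
  π 0 = x ∧ ∀ k < n, G.Adj (π k) (π (k + 1)) ∧ (k % 2 = i → π (k + 1) = σ (history π k))

/-- The strategy `σ` wins from `x` for the player who moves at the times congruent to `i`
modulo `2`: in any play that follows it, it yields a legal move whenever it is that player's turn,
and no such play continues for ever (so every play ends with the opponent unable to move). -/
def IsWinningStrategy {V : Type*} (G : RootedDigraph V) (i : ℕ) (σ : List V → V) (x : V) : Prop :=
  (∀ π n, G.IsPlay i σ x π n → n % 2 = i → G.Adj (π n) (σ (history π n))) ∧
  ¬ ∃ π, ∀ n, G.IsPlay i σ x π n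

/-- The `N`-positions: the first player has a winning strategy. -/
def nPositions {V : Type*} (G : RootedDigraph V) : Set V :=
  {x | x ∈ G.verts ∧ ∃ σ, G.IsWinningStrategy 0 σ x}

/-- The `P`-positions: the second player has a winning strategy. -/
def pPositions {V : Type*} (G : RootedDigraph V) : Set V :=
  {x | x ∈ G.verts ∧ ∃ σ, G.IsWinningStrategy 1 σ x}

/-- From every position, one of the two players has a winning strategy. -/
def IsDrawFree {V : Type*} (G : RootedDigraph V) : Prop :=
  ∀ x ∈ G.verts, x ∈ G.nPositions ∨ x ∈ G.pPositions

/-- Remove all `P`-positions, keep all arcs between the remaining positions, and retain the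
connected component of the root. -/
def reducedComponent {V : Type*} (G : RootedDigraph V) : RootedDigraph V :=
  (G.induce G.pPositionsᶜ).rootComponent

end RootedDigraph

/-! ### Galton-Watson trees -/

/-- Individuals are labelled by words in `ℕ`: the root is the empty word, and the children of `v`
are `v0, v1, …`. Given the family size `ξ v` of every potential individual `v`, the individuals that
are born are the words all of whose letters `j`, following an initial segment `v`, satisfy
`j < ξ v`. -/
def familyTree (ξ : List ℕ → ℕ) : Set (List ℕ) :=
  {u | ∀ (v : List ℕ) (j : ℕ), v ++ [j] <+: u → j < ξ v}

theorem measurable_familyTree : Measurable familyTree := by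
  refine measurable_set_iff.2 fun u => ?_
  refine measurableSet_setOfPred.1 ?_
  have h : {ξ : List ℕ → ℕ | u ∈ familyTree ξ} =
      ⋂ (v : List ℕ), ⋂ (j : ℕ), ⋂ (_ : v ++ [j] <+: u), {ξ | j < ξ v} := by
    ext ξ
    simp [familyTree]
  rw [h]
  exact MeasurableSet.iInter fun v => MeasurableSet.iInter fun j => MeasurableSet.iInter fun _ =>
    measurableSet_lt measurable_const (measurable_pi_apply v)

/-- The law of the set of individuals of a Galton-Watson process with offspring distribution `p`:
the family sizes are independent with law `p`. -/
noncomputable def galtonWatsonLaw (p : PMF ℕ) : Measure (Set (List ℕ)) :=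
  (Measure.infinitePi fun _ : List ℕ => p.toMeasure).map familyTree

instance (p : PMF ℕ) : IsProbabilityMeasure (galtonWatsonLaw p) :=
  Measure.isProbabilityMeasure_map measurable_familyTree.aemeasurable

/-- The directed graph on a set of individuals, with an arc to each child from its parent, rooted
at the empty word. -/
def wordGraph (t : Set (List ℕ)) : RootedDigraph (List ℕ) where
  verts := t
  Adj u v := u ∈ t ∧ v ∈ t ∧ ∃ j : ℕ, v = u ++ [j]
  root := []
  left_mem h := h.1
  right_mem h := h.2.1

/-- Under `μ`, the random rooted directed graph `T` is a Galton-Watson tree with offspring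
distribution `p`: up to isomorphism of rooted directed graphs, it is almost surely the graph of a
Galton-Watson process with offspring distribution `p`. -/
def IsGaltonWatsonTree {Ω V : Type*} [MeasurableSpace Ω] (p : PMF ℕ) (μ : Measure Ω)
    (T : Ω → RootedDigraph V) : Prop :=
  ∃ X : Ω → Set (List ℕ), HasLaw X (galtonWatsonLaw p) μ ∧
    ∀ᵐ ω ∂μ, (T ω).IsIso (wordGraph (X ω))

/-- The probability generating function of a distribution on `ℕ`, used on `[0, 1]`. -/
noncomputable def offspringPGF (p : PMF ℕ) (s : ℝ) : ℝ := ∑' k : ℕ, (p k).toReal * s ^ k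

/-! In a draw-free tree a vertex is an `N`-position exactly when some child is a `P`-position. The
subtrees of the root's children are independent copies of the whole tree, each won by its first
player with probability `q = 1 - P`. Given `n` children, the root is `N` and its `N`-children form a
given set `K` with probability `P ^ (n - |K|) * q ^ |K|` if `K` is proper, and `0` otherwise. Given
`K`, the subtrees at `K` are independent copies conditioned on being `N`. So the tree of
`N`-descendants, renumbered in birth order, branches like a Galton-Watson tree. Its offspring law is
the sum over proper subsets divided by `q`; in the generating function the binomial theorem sums all
subsets, and the missing full set accounts for the subtracted term.

Strategies are replaced by an inductive predicate (`mem_nPositions_iff`, `mem_pPositions_iff`),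
which isomorphisms preserve. On a locally finite tree it means winning in boundedly many moves
(`wins_wordGraph_iff`), a measurable property. The component of the root is identified with a
relabelled tree by `isIso_wordGraph_reduce`. Laws of trees are determined by the probabilities of
containing finite sets of words (`ext_of_containing`). These satisfy the recursions
`familySizeLaw_win_inter` and `familySizeLaw_containing`, which
`familySizeLaw_win_inter_reducedContaining` matches by induction on depth. -/

namespace RootedDigraph

/-! ### Positions of the game as an inductive predicate -/

/-- The player to move can force a win: there is a move to a position all of whose options are
again winning for the player to move. -/
inductive Wins {V : Type*} (G : RootedDigraph V) : V → Prop
  | intro {x y : V} (h : G.Adj x y) (hy : ∀ z, G.Adj y z → Wins G z) : Wins G x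

/-- Every move leads to a position that is winning for the opponent. -/
def Loses {V : Type*} (G : RootedDigraph V) (x : V) : Prop := ∀ y, G.Adj x y → G.Wins y

/-! ### Strategies and the inductive predicate -/

section Strategies

variable {V : Type*} {G : RootedDigraph V}

theorem Wins.not_loses {x : V} (h : G.Wins x) : ¬ G.Loses x := by
  induction h with
  | intro h hy ih =>
    intro hx
    cases hx _ h with
    | intro h' hy' => exact ih _ h' hy'

theorem wins_iff {x : V} : G.Wins x ↔ ∃ y, G.Adj x y ∧ G.Loses y :=
  ⟨fun h => by cases h with | intro h hy => exact ⟨_, h, hy⟩, fun ⟨_, h, hy⟩ => .intro h hy⟩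

theorem history_succ (π : ℕ → V) (n : ℕ) : history π (n + 1) = history π n ++ [π (n + 1)] := by
  simp [history, List.range_succ]

theorem history_eq_append (π : ℕ → V) (n : ℕ) : ∃ l, history π n = l ++ [π n] := by
  cases n with
  | zero => exact ⟨[], rfl⟩
  | succ n => exact ⟨_, history_succ π n⟩

theorem history_succ' (π : ℕ → V) (n : ℕ) :
    history π (n + 1) = π 0 :: history (fun k => π (k + 1)) n := by
  simp [history, List.range_succ_eq_map (n := n + 1), Function.comp_def]

theorem history_zero (π : ℕ → V) : history π 0 = [π 0] := rfl

theorem exists_history_eq_cons (π : ℕ → V) (n : ℕ) : ∃ l, history π n = π 0 :: l := by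
  cases n with
  | zero => exact ⟨[], rfl⟩
  | succ n => exact ⟨_, history_succ' π n⟩

theorem exists_generated_path (s : ℕ → List V → V) (x : V) :
    ∃ π : ℕ → V, π 0 = x ∧ ∀ n, π (n + 1) = s n (history π n) := by
  -- The recursion builds histories rather than positions, because the next position depends on the
  -- whole history.
  let h : ℕ → List V := fun n => Nat.rec [x] (fun n l => l ++ [s n l]) n
  let π : ℕ → V := fun n => Nat.casesOn n x (fun n => s n (h n))
  have hh : ∀ n, history π n = h n := by
    intro n
    induction n with
    | zero => rfl
    | succ n ih => rw [history_succ, ih]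
  exact ⟨π, rfl, fun n => by rw [hh]⟩

theorem isPlay_zero {i : ℕ} {σ : List V → V} {x : V} {π : ℕ → V} :
    G.IsPlay i σ x π 0 ↔ π 0 = x := by simp [IsPlay]

theorem isPlay_succ {i : ℕ} {σ : List V → V} {x : V} {π : ℕ → V} {n : ℕ} :
    G.IsPlay i σ x π (n + 1) ↔ G.IsPlay i σ x π n ∧ G.Adj (π n) (π (n + 1)) ∧
      (n % 2 = i → π (n + 1) = σ (history π n)) := by
  simp only [IsPlay, Nat.forall_lt_succ_right, and_assoc]

/-- Dropping the first move exchanges the two roles, which `hij` expresses; the strategy for the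
remaining play must be given the forgotten position `x` back. -/
theorem isPlay_succ' {i j : ℕ} (hij : ∀ k, (k + 1) % 2 = i ↔ k % 2 = j) {σ : List V → V} {x : V}
    {π : ℕ → V} {n : ℕ} :
    G.IsPlay i σ x π (n + 1) ↔ π 0 = x ∧ G.Adj x (π 1) ∧ (0 = i → π 1 = σ [x]) ∧
      G.IsPlay j (fun h => σ (x :: h)) (π 1) (fun k => π (k + 1)) n := by
  constructor
  · rintro ⟨rfl, h⟩
    refine ⟨rfl, (h 0 (by omega)).1, fun hi => (h 0 (by omega)).2 hi, rfl, fun k hk => ?_⟩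
    have := h (k + 1) (by omega)
    rw [hij, history_succ'] at this
    exact this
  · rintro ⟨rfl, h1, h2, -, h3⟩
    refine ⟨rfl, fun k hk => ?_⟩
    cases k with
    | zero => exact ⟨h1, fun hi => h2 hi⟩
    | succ k =>
      rw [hij, history_succ']
      exact h3 k (by omega)

theorem IsPlay.mono {i : ℕ} {σ : List V → V} {x : V} {π : ℕ → V} {m n : ℕ} (hmn : m ≤ n)
    (h : G.IsPlay i σ x π n) : G.IsPlay i σ x π m :=
  ⟨h.1, fun k hk => h.2 k (by omega)⟩

theorem IsPlay.congr {i : ℕ} {σ σ' : List V → V} {x : V} {π : ℕ → V} {n : ℕ}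
    (hσ : ∀ k, σ (history π k) = σ' (history π k)) (h : G.IsPlay i σ x π n) :
    G.IsPlay i σ' x π n :=
  ⟨h.1, fun k hk => hσ k ▸ h.2 k hk⟩

theorem mem_nPositions_of_adj {x y : V} (h : G.Adj x y) (hy : y ∈ G.pPositions) :
    x ∈ G.nPositions := by
  obtain ⟨-, τ, hτ, hτ'⟩ := hy
  -- Move to `y` first, then answer as the second player of the game started at `y`.
  let σ : List V → V := fun l => if l.tail = [] then y else τ l.tail
  have key : ∀ π n, G.IsPlay 0 σ x π (n + 1) →
      G.IsPlay 1 τ y (fun k => π (k + 1)) n := by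
    intro π n hπ
    rw [isPlay_succ' (j := 1) (by omega)] at hπ
    obtain ⟨-, -, h1, h2⟩ := hπ
    have h1 : π 1 = y := h1 rfl
    rw [h1] at h2
    refine h2.congr fun k => ?_
    obtain ⟨l, hl⟩ := exists_history_eq_cons (fun k => π (k + 1)) k
    simp [σ, hl]
  refine ⟨G.left_mem h, σ, ?_, ?_⟩
  · intro π n hπ hn
    cases n with
    | zero =>
      rw [isPlay_zero] at hπ
      simpa [history_zero, σ, hπ] using h
    | succ n =>
      have := hτ _ _ (key π n hπ) (by omega)
      rw [history_succ']
      obtain ⟨l, hl⟩ := exists_history_eq_cons (fun k => π (k + 1)) n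
      simpa [σ, hl] using this
  · rintro ⟨π, hπ⟩
    exact hτ' ⟨_, fun n => key π n (hπ _)⟩

theorem mem_pPositions_of_forall_adj {x : V} (hx : x ∈ G.verts)
    (h : ∀ y, G.Adj x y → y ∈ G.nPositions) : x ∈ G.pPositions := by
  choose! σ hσ using fun y hy => (h y hy).2
  -- The second entry of the history is the opponent's first move and selects the strategy to
  -- follow. The default `x` concerns only histories of length at most one, when it is not this
  -- player's turn.
  let τ : List V → V := fun l => σ (l.tail.headD x) l.tail
  have key : ∀ π n, G.IsPlay 1 τ x π (n + 1) →
      G.IsPlay 0 (σ (π 1)) (π 1) (fun k => π (k + 1)) n ∧ G.Adj x (π 1) := by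
    intro π n hπ
    rw [isPlay_succ' (j := 0) (by omega)] at hπ
    obtain ⟨-, h1, -, h2⟩ := hπ
    refine ⟨h2.congr fun k => ?_, h1⟩
    obtain ⟨l, hl⟩ := exists_history_eq_cons (fun k => π (k + 1)) k
    simp [τ, hl]
  refine ⟨hx, τ, ?_, ?_⟩
  · intro π n hπ hn
    cases n with
    | zero => omega
    | succ n =>
      have := (hσ _ (key π n hπ).2).1 _ _ (key π n hπ).1 (by omega)
      rw [history_succ']
      obtain ⟨l, hl⟩ := exists_history_eq_cons (fun k => π (k + 1)) n
      simpa [τ, hl] using this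
  · rintro ⟨π, hπ⟩
    exact (hσ _ (key π 0 (hπ _)).2).2 ⟨_, fun n => (key π n (hπ _)).1⟩

theorem mem_nPositions_of_mem_pPositions {x y : V} (hx : x ∈ G.pPositions) (h : G.Adj x y) :
    y ∈ G.nPositions := by
  obtain ⟨-, τ, hτ, hτ'⟩ := hx
  let c : (ℕ → V) → ℕ → V := fun π n => Nat.casesOn n x π
  have key : ∀ π n, G.IsPlay 0 (fun l => τ (x :: l)) y π n → G.IsPlay 1 τ x (c π) (n + 1) := by
    intro π n hπ
    rw [isPlay_succ' (j := 0) (by omega)]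
    have h0 : π 0 = y := hπ.1
    exact ⟨rfl, by simpa [c, h0] using h, by simp, by simpa [c, h0] using hπ⟩
  refine ⟨G.right_mem h, fun l => τ (x :: l), ?_, ?_⟩
  · intro π n hπ hn
    have := hτ _ _ (key π n hπ) (by omega)
    rw [history_succ'] at this
    exact this
  · rintro ⟨π, hπ⟩
    exact hτ' ⟨c π, fun n => (key π n (hπ _)).mono (by omega)⟩

/-- From a position outside `Wins`, every move of `σ` reaches a position that has a successor
outside `Wins`. An opponent who always chooses such a successor makes the play infinite, so `σ` does
not win. -/
theorem wins_of_mem_nPositions {x : V} (hx : x ∈ G.nPositions) : G.Wins x := by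
  obtain ⟨-, σ, hσ, hσ'⟩ := hx
  by_contra hw
  have hr : ∀ y, ∃ z, ¬ G.Loses y → G.Adj y z ∧ ¬ G.Wins z := by
    intro y
    by_cases hy : G.Loses y
    · exact ⟨y, fun h => (h hy).elim⟩
    · obtain ⟨z, hz⟩ : ∃ z, G.Adj y z ∧ ¬ G.Wins z := by
        simpa [Loses] using hy
      exact ⟨z, fun _ => hz⟩
  choose r hr using hr
  obtain ⟨π, h0, hπ⟩ := exists_generated_path
    (fun n l => if n % 2 = 0 then σ l else r (l.getLastD x)) x
  have key : ∀ n, G.IsPlay 0 σ x π (2 * n) ∧ ¬ G.Wins (π (2 * n)) := by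
    intro n
    induction n with
    | zero => exact ⟨isPlay_zero.2 h0, by rwa [h0]⟩
    | succ n ih =>
      have h1 := hσ π (2 * n) ih.1 (by omega)
      have e1 : π (2 * n + 1) = σ (history π (2 * n)) := by
        rw [hπ, if_pos (by omega)]
      rw [← e1] at h1
      have e2 : π (2 * n + 1 + 1) = r (π (2 * n + 1)) := by
        rw [hπ, if_neg (by omega)]
        obtain ⟨l, hl⟩ := history_eq_append π (2 * n + 1)
        rw [hl, List.getLastD_concat]
      have h2 := hr (π (2 * n + 1)) fun h => ih.2 (wins_iff.2 ⟨_, h1, h⟩)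
      rw [← e2] at h2
      have h3 : G.IsPlay 0 σ x π (2 * n + 1 + 1) :=
        isPlay_succ.2 ⟨isPlay_succ.2 ⟨ih.1, h1, fun _ => e1⟩, h2.1, fun h => by omega⟩
      exact ⟨h3, h2.2⟩
  exact hσ' ⟨π, fun n => (key n).1.mono (by omega)⟩

theorem mem_nPositions_of_wins {x : V} (hx : G.Wins x) : x ∈ G.nPositions := by
  induction hx with
  | intro h hy ih => exact mem_nPositions_of_adj h (mem_pPositions_of_forall_adj (G.right_mem h) ih)

theorem mem_nPositions_iff {x : V} : x ∈ G.nPositions ↔ G.Wins x :=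
  ⟨wins_of_mem_nPositions, mem_nPositions_of_wins⟩

theorem mem_pPositions_iff {x : V} : x ∈ G.pPositions ↔ x ∈ G.verts ∧ G.Loses x :=
  ⟨fun h => ⟨h.1, fun _ hy => wins_of_mem_nPositions (mem_nPositions_of_mem_pPositions h hy)⟩,
    fun h => mem_pPositions_of_forall_adj h.1 fun y hy => mem_nPositions_of_wins (h.2 y hy)⟩

theorem isDrawFree_iff : G.IsDrawFree ↔ ∀ x ∈ G.verts, G.Wins x ∨ G.Loses x := by
  refine forall₂_congr fun x hx => ?_
  rw [mem_nPositions_iff, mem_pPositions_iff, and_iff_right hx]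

end Strategies

/-! ### Invariance under isomorphism -/

section Iso

variable {U V W : Type*} {F : RootedDigraph U} {G : RootedDigraph V} {H : RootedDigraph W}

theorem IsIso.trans (h : F.IsIso G) (h' : G.IsIso H) : F.IsIso H := by
  obtain ⟨e, he, he'⟩ := h
  obtain ⟨f, hf, hf'⟩ := h'
  exact ⟨e.trans f, fun x y => (he x y).trans (hf _ _), fun x => (he' x).trans (hf' _)⟩

theorem IsIso.symm (h : G.IsIso H) : H.IsIso G := by
  obtain ⟨e, he, he'⟩ := h
  refine ⟨e.symm, fun x y => ?_, fun x => ?_⟩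
  · simp [he]
  · simp [he']

theorem Wins.map {e : G.verts ≃ H.verts} (he : ∀ x y : G.verts, G.Adj x y ↔ H.Adj (e x) (e y))
    {x : V} (h : G.Wins x) (hx : x ∈ G.verts) : H.Wins (e ⟨x, hx⟩) := by
  induction h with
  | @intro x y h hy ih =>
    refine .intro ((he ⟨x, hx⟩ ⟨y, G.right_mem h⟩).1 h) fun z hz => ?_
    have hz' := H.right_mem hz
    have h2 : G.Adj y (e.symm ⟨z, hz'⟩) := by
      refine (he ⟨y, G.right_mem h⟩ (e.symm ⟨z, hz'⟩)).2 ?_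
      simpa using hz
    simpa using ih _ h2 (e.symm ⟨z, hz'⟩).2

theorem wins_apply_iff {e : G.verts ≃ H.verts}
    (he : ∀ x y : G.verts, G.Adj x y ↔ H.Adj (e x) (e y)) (x : G.verts) :
    H.Wins (e x) ↔ G.Wins x := by
  refine ⟨fun h => ?_, fun h => h.map he x.2⟩
  have := h.map (e := e.symm) (fun x y => by simp [he]) (e x).2
  simpa using this

theorem loses_apply_iff {e : G.verts ≃ H.verts}
    (he : ∀ x y : G.verts, G.Adj x y ↔ H.Adj (e x) (e y)) (x : G.verts) :
    H.Loses (e x) ↔ G.Loses x := by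
  constructor
  · intro h y hy
    exact (wins_apply_iff he ⟨y, G.right_mem hy⟩).1 (h _ ((he _ _).1 hy))
  · intro h y hy
    obtain ⟨z, hz⟩ := e.surjective ⟨y, H.right_mem hy⟩
    have hz' : (e z : W) = y := by rw [hz]
    rw [← hz'] at hy ⊢
    exact (wins_apply_iff he z).2 (h _ ((he _ _).2 hy))

theorem IsIso.isDrawFree (h : G.IsIso H) (hG : G.IsDrawFree) : H.IsDrawFree := by
  obtain ⟨e, he, -⟩ := h
  rw [isDrawFree_iff] at hG ⊢
  intro y hy
  obtain ⟨x, hx⟩ := e.surjective ⟨y, hy⟩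
  have hx' : (e x : W) = y := by rw [hx]
  rw [← hx', wins_apply_iff he, loses_apply_iff he]
  exact hG x x.2

theorem IsIso.root_wins (h : G.IsIso H) (hG : G.Wins G.root) : H.Wins H.root := by
  obtain ⟨e, he, he'⟩ := h
  have hv : G.root ∈ G.verts := (mem_nPositions_of_wins hG).1
  rw [← (he' ⟨_, hv⟩).1 rfl]
  exact (wins_apply_iff he _).2 hG

theorem IsIso.root_mem_nPositions_iff (h : G.IsIso H) :
    G.root ∈ G.nPositions ↔ H.root ∈ H.nPositions := by
  rw [mem_nPositions_iff, mem_nPositions_iff]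
  exact ⟨h.root_wins, h.symm.root_wins⟩

theorem IsIso.root_mem_pPositions (h : G.IsIso H) (hG : G.root ∈ G.pPositions) :
    H.root ∈ H.pPositions := by
  obtain ⟨e, he, he'⟩ := h
  have hv : G.root ∈ G.verts := hG.1
  rw [← (he' ⟨_, hv⟩).1 rfl]
  exact mem_pPositions_iff.2 ⟨(e ⟨_, hv⟩).2,
    (loses_apply_iff he _).2 (mem_pPositions_iff.1 hG).2⟩

theorem IsIso.root_mem_pPositions_iff (h : G.IsIso H) :
    G.root ∈ G.pPositions ↔ H.root ∈ H.pPositions :=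
  ⟨h.root_mem_pPositions, h.symm.root_mem_pPositions⟩

theorem isIso_induce (e : G.verts ≃ H.verts)
    (he : ∀ x y : G.verts, G.Adj x y ↔ H.Adj (e x) (e y))
    (he' : ∀ x : G.verts, (x : V) = G.root ↔ (e x : W) = H.root) {S : Set V} {S' : Set W}
    (hS : ∀ x : G.verts, (x : V) ∈ S ↔ (e x : W) ∈ S') :
    (G.induce S).IsIso (H.induce S') := by
  let f : (G.induce S).verts ≃ (H.induce S').verts :=
    { toFun := fun x => ⟨e ⟨x, x.2.1⟩, (e ⟨x, x.2.1⟩).2, (hS ⟨x, x.2.1⟩).1 x.2.2⟩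
      invFun := fun y => ⟨e.symm ⟨y, y.2.1⟩, (e.symm ⟨y, y.2.1⟩).2,
        (hS (e.symm ⟨y, y.2.1⟩)).2 (by simpa using y.2.2)⟩
      left_inv := fun x => by simp
      right_inv := fun y => by simp }
  refine ⟨f, fun x y => ?_, fun x => he' ⟨x, x.2.1⟩⟩
  exact and_congr (he ⟨x, x.2.1⟩ ⟨y, y.2.1⟩)
    (and_congr (hS ⟨x, x.2.1⟩) (hS ⟨y, y.2.1⟩))

/-- `Relation.EqvGen` is reflexive also at points that are not vertices, where `e` is undefined;
hence the alternative `x = y`. -/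
theorem eqvGen_map (e : G.verts ≃ H.verts)
    (he : ∀ x y : G.verts, G.Adj x y ↔ H.Adj (e x) (e y)) {x y : V}
    (h : Relation.EqvGen G.Adj x y) :
    x = y ∨ ∃ (hx : x ∈ G.verts) (hy : y ∈ G.verts),
      Relation.EqvGen H.Adj (e ⟨x, hx⟩) (e ⟨y, hy⟩) := by
  induction h with
  | rel x y h => exact .inr ⟨G.left_mem h, G.right_mem h, .rel _ _ ((he ⟨x, _⟩ ⟨y, _⟩).1 h)⟩
  | refl x => exact .inl rfl
  | symm x y _ ih =>
    rcases ih with rfl | ⟨hx, hy, h⟩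
    · exact .inl rfl
    · exact .inr ⟨hy, hx, h.symm⟩
  | trans x y z _ _ ih1 ih2 =>
    rcases ih1 with rfl | ⟨hx, hy, h⟩
    · exact ih2
    · rcases ih2 with rfl | ⟨_, hz, h'⟩
      · exact .inr ⟨hx, hy, h⟩
      · exact .inr ⟨hx, hz, h.trans _ _ _ h'⟩

theorem eqvGen_root_map (e : G.verts ≃ H.verts)
    (he : ∀ x y : G.verts, G.Adj x y ↔ H.Adj (e x) (e y))
    (he' : ∀ x : G.verts, (x : V) = G.root ↔ (e x : W) = H.root) (x : G.verts)
    (h : Relation.EqvGen G.Adj G.root x) : Relation.EqvGen H.Adj H.root (e x) := by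
  rcases eqvGen_map e he h with h | ⟨hx, hy, h⟩
  · rw [(he' x).1 h.symm]
    exact .refl _
  · rwa [(he' ⟨_, hx⟩).1 rfl] at h

theorem IsIso.rootComponent (h : G.IsIso H) : G.rootComponent.IsIso H.rootComponent := by
  obtain ⟨e, he, he'⟩ := h
  refine isIso_induce e he he'
    (S := {x | Relation.EqvGen G.Adj G.root x}) (S' := {x | Relation.EqvGen H.Adj H.root x})
    fun x => ⟨eqvGen_root_map e he he' x, fun h => by
      have := eqvGen_root_map e.symm (fun x y => by simp [he]) (fun x => by simp [he']) (e x) h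
      simpa using this⟩

theorem IsIso.reducedComponent (h : G.IsIso H) :
    G.reducedComponent.IsIso H.reducedComponent := by
  obtain ⟨e, he, he'⟩ := h
  refine (isIso_induce e he he' (S := G.pPositionsᶜ) (S' := H.pPositionsᶜ)
    fun x => by
      simp only [Set.mem_compl_iff, mem_pPositions_iff, loses_apply_iff he, x.2, (e x).2]).rootComponent

end Iso

end RootedDigraph

/-! ### The game on a family tree -/

/-- The descendants of the individual `u`, labelled relative to `u`. -/
def subtree (t : Set (List ℕ)) (u : List ℕ) : Set (List ℕ) := {v | u ++ v ∈ t}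

@[simp] theorem mem_subtree {t : Set (List ℕ)} {u v : List ℕ} : v ∈ subtree t u ↔ u ++ v ∈ t :=
  Iff.rfl

@[simp] theorem subtree_nil (t : Set (List ℕ)) : subtree t [] = t := rfl

@[simp] theorem subtree_subtree (t : Set (List ℕ)) (u v : List ℕ) :
    subtree (subtree t u) v = subtree t (u ++ v) := by
  ext w
  simp

/-- A set of words that is a locally finite tree. -/
structure IsLocallyFiniteTree (t : Set (List ℕ)) : Prop where
  nil_mem : [] ∈ t
  mem_of_append : ∀ u j, u ++ [j] ∈ t → u ∈ t
  exists_bound : ∀ u, ∃ b, ∀ j, u ++ [j] ∈ t → j < b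

theorem isLocallyFiniteTree_familyTree (ξ : List ℕ → ℕ) :
    IsLocallyFiniteTree (familyTree ξ) where
  nil_mem v j h := by simp at h
  mem_of_append u j h v k hv := h v k (hv.trans (List.prefix_append u [j]))
  exists_bound u := ⟨ξ u, fun j h => h u j List.prefix_rfl⟩

/-- The player to move at the root can force a win within `2 * n - 1` moves. -/
def WinIn : ℕ → Set (List ℕ) → Prop
  | 0, _ => False
  | n + 1, t => ∃ i, [i] ∈ t ∧ ∀ j, [i, j] ∈ t → WinIn n (subtree t [i, j])

/-- The player to move at the root can force a win within a bounded number of moves. -/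
def Win (t : Set (List ℕ)) : Prop := ∃ n, WinIn n t

/-- No position of the tree is a draw. -/
def NoDraw (t : Set (List ℕ)) : Prop :=
  ∀ u ∈ t, Win (subtree t u) ∨ ∀ j, u ++ [j] ∈ t → Win (subtree t (u ++ [j]))

theorem WinIn.succ {n : ℕ} {t : Set (List ℕ)} (h : WinIn n t) : WinIn (n + 1) t := by
  induction n generalizing t with
  | zero => exact h.elim
  | succ n ih =>
    obtain ⟨i, hi, h⟩ := h
    exact ⟨i, hi, fun j hj => ih (h j hj)⟩

theorem WinIn.mono {m n : ℕ} (hmn : m ≤ n) {t : Set (List ℕ)} (h : WinIn m t) : WinIn n t := by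
  induction hmn with
  | refl => exact h
  | step _ ih => exact ih.succ

section Tree

variable {t : Set (List ℕ)}

theorem WinIn.wins {n : ℕ} {u : List ℕ} (hu : u ∈ t) (h : WinIn n (subtree t u)) :
    (wordGraph t).Wins u := by
  induction n generalizing u with
  | zero => exact h.elim
  | succ n ih =>
    obtain ⟨i, hi, h⟩ := h
    refine .intro (y := u ++ [i]) ⟨hu, hi, i, rfl⟩ ?_
    rintro z ⟨-, hz, j, rfl⟩
    refine ih hz ?_
    have := h j (by simpa using hz)
    simpa using this

/-- After the winning move the opponent has finitely many replies, so the bounds on the number of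
further moves have a maximum. This is where local finiteness enters. -/
theorem win_of_wins (ht : IsLocallyFiniteTree t) {u : List ℕ} (h : (wordGraph t).Wins u) :
    Win (subtree t u) := by
  induction h with
  | @intro x y h hy ih =>
    obtain ⟨-, hyt, i, rfl⟩ := h
    obtain ⟨b, hb⟩ := ht.exists_bound (x ++ [i])
    have hn : ∀ j, ∃ n, x ++ [i] ++ [j] ∈ t → WinIn n (subtree t (x ++ [i] ++ [j])) := by
      intro j
      by_cases hj : x ++ [i] ++ [j] ∈ t
      · exact (ih _ ⟨hyt, hj, j, rfl⟩).imp fun n hn _ => hn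
      · exact ⟨0, fun h => (hj h).elim⟩
    choose N hN using hn
    refine ⟨(Finset.range b).sup N + 1, i, hyt, fun j hj => ?_⟩
    have hj' : x ++ [i] ++ [j] ∈ t := by simpa using hj
    have := (hN j hj').mono (Finset.le_sup (Finset.mem_range.2 (hb j hj')))
    simpa using this

theorem wins_wordGraph_iff (ht : IsLocallyFiniteTree t) {u : List ℕ} (hu : u ∈ t) :
    (wordGraph t).Wins u ↔ Win (subtree t u) :=
  ⟨win_of_wins ht, fun ⟨_, h⟩ => h.wins hu⟩

theorem loses_wordGraph_iff (ht : IsLocallyFiniteTree t) {u : List ℕ} (hu : u ∈ t) :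
    (wordGraph t).Loses u ↔ ∀ j, u ++ [j] ∈ t → Win (subtree t (u ++ [j])) := by
  constructor
  · exact fun h j hj => win_of_wins ht (h _ ⟨hu, hj, j, rfl⟩)
  · rintro h y ⟨-, hy, j, rfl⟩
    exact (wins_wordGraph_iff ht hy).2 (h j hy)

theorem isDrawFree_wordGraph_iff (ht : IsLocallyFiniteTree t) :
    (wordGraph t).IsDrawFree ↔ NoDraw t := by
  rw [RootedDigraph.isDrawFree_iff]
  refine forall₂_congr fun u hu => ?_
  rw [wins_wordGraph_iff ht hu, loses_wordGraph_iff ht hu]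

theorem not_win_iff (ht : IsLocallyFiniteTree t) (hd : NoDraw t) {u : List ℕ} (hu : u ∈ t) :
    ¬ Win (subtree t u) ↔ ∀ j, u ++ [j] ∈ t → Win (subtree t (u ++ [j])) := by
  constructor
  · exact fun h => (hd u hu).resolve_left h
  · intro h h'
    exact ((wins_wordGraph_iff ht hu).2 h').not_loses ((loses_wordGraph_iff ht hu).2 h)

theorem mem_pPositions_wordGraph_iff (ht : IsLocallyFiniteTree t) (hd : NoDraw t) {u : List ℕ} :
    u ∈ (wordGraph t).pPositions ↔ u ∈ t ∧ ¬ Win (subtree t u) := by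
  rw [RootedDigraph.mem_pPositions_iff]
  refine and_congr_right fun hu => ?_
  rw [not_win_iff ht hd hu, loses_wordGraph_iff ht hu]

theorem nil_mem_nPositions_wordGraph_iff (ht : IsLocallyFiniteTree t) :
    [] ∈ (wordGraph t).nPositions ↔ Win t := by
  rw [RootedDigraph.mem_nPositions_iff, wins_wordGraph_iff ht ht.nil_mem, subtree_nil]

theorem nil_mem_pPositions_wordGraph_iff (ht : IsLocallyFiniteTree t) (hd : NoDraw t) :
    [] ∈ (wordGraph t).pPositions ↔ ¬ Win t := by
  rw [mem_pPositions_wordGraph_iff ht hd, and_iff_right ht.nil_mem, subtree_nil]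

end Tree

/-! ### The reduced tree -/

/-- The `i`-th child of the root is winning for the player to move. -/
def WinningChild (t : Set (List ℕ)) (i : ℕ) : Prop := [i] ∈ t ∧ Win (subtree t [i])

/-- All individuals on the line of descent to the given word, except perhaps the root, are winning
for the player to move. -/
def Survives : List ℕ → Set (List ℕ) → Prop
  | [], _ => True
  | i :: u, t => WinningChild t i ∧ Survives u (subtree t [i])

open Classical in
/-- The label of a surviving individual once all its ancestors' siblings that do not survive have
been removed. -/
noncomputable def relabel : List ℕ → Set (List ℕ) → List ℕ
  | [], _ => []
  | i :: u, t => Nat.count (WinningChild t) i :: relabel u (subtree t [i])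

open Classical in
/-- Membership in the relabelled tree of surviving individuals. -/
def MemReduce : List ℕ → Set (List ℕ) → Prop
  | [], _ => True
  | k :: u, t =>
    ∃ i, WinningChild t i ∧ Nat.count (WinningChild t) i = k ∧ MemReduce u (subtree t [i])

/-- The relabelled tree of surviving individuals. -/
def reduce (t : Set (List ℕ)) : Set (List ℕ) := {u | MemReduce u t}

section Reduce

variable {t : Set (List ℕ)}

theorem survives_append {u v : List ℕ} :
    Survives (u ++ v) t ↔ Survives u t ∧ Survives v (subtree t u) := by
  induction u generalizing t with
  | nil => simp [Survives]
  | cons i u ih => simp [Survives, ih, and_assoc]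

theorem relabel_append {u v : List ℕ} :
    relabel (u ++ v) t = relabel u t ++ relabel v (subtree t u) := by
  induction u generalizing t with
  | nil => simp [relabel]
  | cons i u ih => simp [relabel, ih]

/-- The number of earlier winning siblings determines a winning child, so letters are recovered one
generation at a time. -/
theorem relabel_injective {u v : List ℕ} (hu : Survives u t) (hv : Survives v t)
    (h : relabel u t = relabel v t) : u = v := by
  induction u generalizing t v with
  | nil =>
    cases v with
    | nil => rfl
    | cons j v => simp [relabel] at h
  | cons i u ih =>
    cases v with
    | nil => simp [relabel] at h
    | cons j v =>
      simp only [relabel, List.cons.injEq] at h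
      obtain rfl : i = j := by
        classical exact Nat.count_injective hu.1 hv.1 h.1
      rw [ih hu.2 hv.2 h.2]

theorem length_relabel (u : List ℕ) : (relabel u t).length = u.length := by
  induction u generalizing t with
  | nil => rfl
  | cons i u ih => simp [relabel, ih]

theorem mem_reduce_iff {w : List ℕ} : w ∈ reduce t ↔ ∃ u, Survives u t ∧ relabel u t = w := by
  change MemReduce w t ↔ _
  induction w generalizing t with
  | nil =>
    exact ⟨fun _ => ⟨[], trivial, rfl⟩, fun _ => trivial⟩
  | cons k w ih =>
    constructor
    · rintro ⟨i, hi, hk, h⟩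
      obtain ⟨u, hu, hw⟩ := ih.1 h
      exact ⟨i :: u, ⟨hi, hu⟩, by rw [relabel, hk, hw]⟩
    · rintro ⟨u, hu, hw⟩
      cases u with
      | nil => simp [relabel] at hw
      | cons i u =>
        simp only [relabel, List.cons.injEq] at hw
        exact ⟨i, hu.1, hw.1, ih.2 ⟨u, hu.2, hw.2⟩⟩

theorem Survives.mem {u : List ℕ} (ht : [] ∈ t) (hu : Survives u t) : u ∈ t := by
  induction u generalizing t with
  | nil => exact ht
  | cons i u ih => exact ih (by simpa using hu.1.1) hu.2

theorem Survives.win {u : List ℕ} (ht : Win t) (hu : Survives u t) : Win (subtree t u) := by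
  induction u generalizing t with
  | nil => exact ht
  | cons i u ih => simpa using ih hu.1.2 hu.2

theorem survives_append_singleton {u : List ℕ} {j : ℕ} :
    Survives (u ++ [j]) t ↔
      Survives u t ∧ u ++ [j] ∈ t ∧ Win (subtree t (u ++ [j])) := by
  simp [survives_append, Survives, WinningChild]

theorem exists_eq_append_of_relabel_eq {u v : List ℕ} {k : ℕ} (hu : Survives u t)
    (hv : Survives v t) (h : relabel v t = relabel u t ++ [k]) : ∃ j, v = u ++ [j] := by
  rcases v.eq_nil_or_concat with rfl | ⟨w, j, rfl⟩
  · simp [relabel] at h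
  · rw [List.concat_eq_append, relabel_append] at h
    rw [List.concat_eq_append] at hv ⊢
    simp only [relabel] at h
    rw [← relabel_injective (survives_append.1 hv).1 hu (List.append_inj' h rfl).1]
    exact ⟨j, rfl⟩

/-- Survival is unchanged along every arc between remaining positions, hence constant on components.
Conversely, the line of descent of a survivor joins it to the root; `hw` keeps the root itself. -/
theorem mem_verts_reducedComponent_iff (ht : IsLocallyFiniteTree t) (hd : NoDraw t) (hw : Win t)
    {u : List ℕ} : u ∈ (wordGraph t).reducedComponent.verts ↔ Survives u t := by
  have hP : ∀ v, v ∈ t → (v ∈ (wordGraph t).pPositionsᶜ ↔ Win (subtree t v)) := fun v hv => by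
    rw [Set.mem_compl_iff, mem_pPositions_wordGraph_iff ht hd]
    tauto
  constructor
  · rintro ⟨-, hu⟩
    have key : ∀ x y, Relation.EqvGen ((wordGraph t).induce (wordGraph t).pPositionsᶜ).Adj x y →
        (Survives x t ↔ Survives y t) := by
      intro x y hxy
      induction hxy with
      | rel x y h =>
        obtain ⟨⟨-, hy, j, rfl⟩, -, hyP⟩ := h
        rw [survives_append_singleton, and_iff_left ⟨hy, (hP _ hy).1 hyP⟩]
      | refl x => rfl
      | symm x y _ ih => exact ih.symm
      | trans x y z _ _ ih1 ih2 => exact ih1.trans ih2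
    exact (key _ _ hu).1 trivial
  · intro hu
    have hut := hu.mem ht.nil_mem
    refine ⟨⟨hut, (hP u hut).2 (hu.win hw)⟩, ?_⟩
    change Relation.EqvGen _ [] u
    clear hut
    induction u using List.reverseRecOn with
    | nil => exact .refl _
    | append_singleton u j ih =>
      have hu' := (survives_append_singleton.1 hu).1
      refine (ih hu').trans _ _ _ (.rel _ _ ⟨⟨hu'.mem ht.nil_mem, hu.mem ht.nil_mem, j, rfl⟩, ?_, ?_⟩)
      · exact (hP _ (hu'.mem ht.nil_mem)).2 (hu'.win hw)
      · exact (hP _ (hu.mem ht.nil_mem)).2 (hu.win hw)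

theorem isIso_wordGraph_reduce (ht : IsLocallyFiniteTree t) (hd : NoDraw t) (hw : Win t) :
    (wordGraph t).reducedComponent.IsIso (wordGraph (reduce t)) := by
  have hS := fun u => mem_verts_reducedComponent_iff ht hd hw (u := u)
  let f : (wordGraph t).reducedComponent.verts → (wordGraph (reduce t)).verts :=
    fun u => ⟨relabel u t, mem_reduce_iff.2 ⟨u, (hS u).1 u.2, rfl⟩⟩
  have hf : Function.Bijective f := by
    constructor
    · intro u v h
      exact Subtype.ext (relabel_injective ((hS u).1 u.2) ((hS v).1 v.2) (congrArg Subtype.val h))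
    · rintro ⟨w, hw'⟩
      obtain ⟨u, hu, h⟩ := mem_reduce_iff.1 hw'
      exact ⟨⟨u, (hS u).2 hu⟩, Subtype.ext h⟩
  refine ⟨Equiv.ofBijective f hf, fun u v => ?_, fun u => ?_⟩
  · have hu := (hS u).1 u.2
    have hv := (hS v).1 v.2
    constructor
    · rintro ⟨⟨⟨-, -, j, hj⟩, -⟩, -⟩
      refine ⟨(f u).2, (f v).2, ?_⟩
      change ∃ k, relabel v t = relabel u t ++ [k]
      rw [hj, relabel_append]
      exact ⟨_, rfl⟩
    · rintro ⟨-, -, k, hk⟩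
      obtain ⟨j, hj⟩ := exists_eq_append_of_relabel_eq hu hv hk
      exact ⟨⟨⟨u.2.1.1, v.2.1.1, j, hj⟩, u.2.1.2, v.2.1.2⟩, u.2.2, v.2.2⟩
  · change (u : List ℕ) = [] ↔ relabel u t = []
    rw [← List.length_eq_zero_iff, ← List.length_eq_zero_iff, length_relabel]

end Reduce

/-! ### Measurability -/

theorem measurable_word_mem (u : List ℕ) : Measurable fun t : Set (List ℕ) => u ∈ t :=
  measurable_set_iff.1 measurable_id u

theorem measurable_subtree (u : List ℕ) : Measurable fun t => subtree t u :=
  measurable_set_iff.2 fun v => measurable_word_mem (u ++ v)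

theorem measurable_winIn (n : ℕ) : Measurable (WinIn n) := by
  induction n with
  | zero => exact measurable_const
  | succ n ih =>
    exact Measurable.exists fun i => (measurable_word_mem _).and <| Measurable.forall fun j =>
      (measurable_word_mem _).imp (ih.comp (measurable_subtree _))

theorem measurable_win : Measurable Win := Measurable.exists measurable_winIn

theorem measurableSet_noDraw : MeasurableSet {t | NoDraw t} :=
  measurableSet_setOfPred.2 <| Measurable.forall fun u => (measurable_word_mem u).imp <|
    (measurable_win.comp (measurable_subtree u)).or <| Measurable.forall fun _ =>
      (measurable_word_mem _).imp (measurable_win.comp (measurable_subtree _))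

theorem measurableSet_isLocallyFiniteTree : MeasurableSet {t | IsLocallyFiniteTree t} := by
  have h : {t | IsLocallyFiniteTree t} = {t | [] ∈ t ∧ (∀ u j, u ++ [j] ∈ t → u ∈ t) ∧
      ∀ u, ∃ b, ∀ j, u ++ [j] ∈ t → j < b} := by
    ext t
    exact ⟨fun h => ⟨h.1, h.2, h.3⟩, fun h => ⟨h.1, h.2.1, h.2.2⟩⟩
  rw [h]
  refine measurableSet_setOfPred.2 ((measurable_word_mem []).and (.and ?_ ?_))
  · exact Measurable.forall fun u => Measurable.forall fun j =>
      (measurable_word_mem _).imp (measurable_word_mem _)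
  · exact Measurable.forall fun u => Measurable.exists fun b => Measurable.forall fun j =>
      (measurable_word_mem _).imp measurable_const

theorem measurable_winningChild (i : ℕ) : Measurable fun t => WinningChild t i :=
  (measurable_word_mem _).and (measurable_win.comp (measurable_subtree _))

open Classical in
theorem measurable_count_winningChild (i : ℕ) :
    Measurable fun t => Nat.count (WinningChild t) i := by
  induction i with
  | zero => simp [measurable_const]
  | succ i ih =>
    simp only [Nat.count_succ]
    exact ih.add (Measurable.ite (measurableSet_setOfPred.2 (measurable_winningChild i))
      measurable_const measurable_const)

theorem measurable_memReduce (u : List ℕ) : Measurable (MemReduce u) := by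
  induction u with
  | nil => exact measurable_const
  | cons k u ih =>
    refine Measurable.exists fun i => (measurable_winningChild i).and (.and ?_ ?_)
    · exact measurableSet_setOfPred.1
        (measurable_count_winningChild i (measurableSet_singleton k))
    · exact ih.comp (measurable_subtree _)

theorem measurable_reduce : Measurable reduce := measurable_set_iff.2 measurable_memReduce

/-! ### Ranks in a finite set of natural numbers -/

/-- The number of elements of `K` below `i`. -/
def Finset.rankOf (K : Finset ℕ) (i : ℕ) : ℕ := (K.filter (· < i)).card

theorem Finset.rankOf_lt_card {K : Finset ℕ} {i : ℕ} (hi : i ∈ K) : K.rankOf i < K.card :=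
  Finset.card_lt_card ⟨Finset.filter_subset _ _, fun h => by simpa using h hi⟩

theorem Finset.rankOf_strictMonoOn (K : Finset ℕ) : StrictMonoOn K.rankOf (K : Set ℕ) := by
  intro i hi j _ hij
  refine Finset.card_lt_card ⟨fun k hk => ?_, fun h => ?_⟩
  · simp only [Finset.mem_filter] at hk ⊢
    exact ⟨hk.1, hk.2.trans hij⟩
  · have := h (Finset.mem_filter.2 ⟨hi, hij⟩)
    simp at this

theorem Finset.image_rankOf (K : Finset ℕ) : K.image K.rankOf = Finset.range K.card := by
  refine Finset.eq_of_subset_of_card_le (fun k hk => ?_) ?_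
  · obtain ⟨i, hi, rfl⟩ := Finset.mem_image.1 hk
    exact Finset.mem_range.2 (Finset.rankOf_lt_card hi)
  · rw [Finset.card_image_of_injOn K.rankOf_strictMonoOn.injOn, Finset.card_range]

theorem Finset.prod_rankOf {M : Type*} [CommMonoid M] (K : Finset ℕ) (f : ℕ → M) :
    ∏ i ∈ K, f (K.rankOf i) = ∏ k ∈ Finset.range K.card, f k := by
  rw [← K.image_rankOf, Finset.prod_image K.rankOf_strictMonoOn.injOn]

/-! ### Independent trials of two types -/

open Classical in
/-- The indices below `n` of the terms of a sequence that lie in `N`. -/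
noncomputable def hits {E : Type*} (N : Set E) (n : ℕ) (τ : ℕ → E) : Finset ℕ :=
  (Finset.range n).filter fun i => τ i ∈ N

theorem mem_hits {E : Type*} {N : Set E} {n : ℕ} {τ : ℕ → E} {i : ℕ} :
    i ∈ hits N n τ ↔ i < n ∧ τ i ∈ N := by
  simp [hits]

section Trials

variable {E : Type*} [MeasurableSpace E] (ν : Measure E) [IsProbabilityMeasure ν]

/-- The hits are exactly the elements of `K`, and the `k`-th hit lies in `C k`. -/
def hitsEq {E : Type*} (N : Set E) (C : ℕ → Set E) (n : ℕ) (K : Finset ℕ) : Set (ℕ → E) :=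
  {τ | hits N n τ = K ∧ ∀ i ∈ K, τ i ∈ C (K.rankOf i)}

open Classical in
-- Once the set of hits is fixed, so are the ranks, and the event splits into one condition per
-- coordinate; independence then applies.
theorem hitsEq_eq_pi {E : Type*} {N : Set E} {C : ℕ → Set E} {n : ℕ} {K : Finset ℕ}
    (hK : K ⊆ Finset.range n) : hitsEq N C n K = Set.pi (Finset.range n)
      (fun i => if i ∈ K then N ∩ C (K.rankOf i) else Nᶜ) := by
  ext τ
  simp only [hitsEq, Set.mem_ofPred_eq, Set.mem_pi, Finset.coe_range, Set.mem_Iio]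
  constructor
  · rintro ⟨rfl, h⟩ i hi
    split_ifs with hiK
    · exact ⟨(mem_hits.1 hiK).2, h i hiK⟩
    · exact fun hN => hiK (mem_hits.2 ⟨hi, hN⟩)
  · intro h
    constructor
    · ext i
      rw [mem_hits]
      constructor
      · rintro ⟨hi, hN⟩
        by_contra hiK
        have := h i hi
        rw [if_neg hiK] at this
        exact this hN
      · intro hiK
        have hi := Finset.mem_range.1 (hK hiK)
        have := h i hi
        rw [if_pos hiK] at this
        exact ⟨hi, this.1⟩
    · intro i hiK
      have := h i (Finset.mem_range.1 (hK hiK))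
      rw [if_pos hiK] at this
      exact this.2

variable {N : Set E} {C : ℕ → Set E} (hN : MeasurableSet N) (hC : ∀ k, MeasurableSet (C k))

include hN hC in
theorem measurableSet_hitsEq (n : ℕ) {K : Finset ℕ} (hK : K ⊆ Finset.range n) :
    MeasurableSet (hitsEq N C n K) := by
  classical
  rw [hitsEq_eq_pi hK]
  refine MeasurableSet.pi (Set.to_countable _) fun i _ => ?_
  split_ifs
  · exact hN.inter (hC _)
  · exact hN.compl

include hN hC in
-- Only the size of `K` matters, not its position: this is why renumbering the hits leaves
-- independent, identically distributed terms.
theorem infinitePi_hitsEq (n : ℕ) {K : Finset ℕ} (hK : K ⊆ Finset.range n) :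
    Measure.infinitePi (fun _ : ℕ => ν) (hitsEq N C n K) =
      ν Nᶜ ^ (n - K.card) * ∏ k ∈ Finset.range K.card, ν (N ∩ C k) := by
  classical
  rw [hitsEq_eq_pi hK, Measure.infinitePi_pi, ← Finset.prod_sdiff hK]
  · congr 1
    · rw [Finset.prod_congr rfl (g := fun _ => ν Nᶜ), Finset.prod_const,
        Finset.card_sdiff_of_subset hK, Finset.card_range]
      intro i hi
      rw [if_neg (Finset.mem_sdiff.1 hi).2]
    · rw [← K.prod_rankOf]
      exact Finset.prod_congr rfl fun i hi => by rw [if_pos hi]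
  · intro i _
    split_ifs
    · exact hN.inter (hC _)
    · exact hN.compl

/-- Not all of the first `n` terms are hits, the number of hits is in `R`, and the `k`-th hit lies
in `C k`. -/
def hitsIn {E : Type*} (N : Set E) (C : ℕ → Set E) (R : Set ℕ) (n : ℕ) : Set (ℕ → E) :=
  {τ | (∃ i < n, τ i ∉ N) ∧ (hits N n τ).card ∈ R ∧
    ∀ i ∈ hits N n τ, τ i ∈ C ((hits N n τ).rankOf i)}

open Classical in
theorem hitsIn_eq_biUnion {E : Type*} (N : Set E) (C : ℕ → Set E) (R : Set ℕ) (n : ℕ) :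
    hitsIn N C R n =
      ⋃ K ∈ (Finset.range n).ssubsets.filter (fun K => K.card ∈ R), hitsEq N C n K := by
  ext τ
  simp only [hitsIn, Set.mem_ofPred_eq, Set.mem_iUnion, Finset.mem_filter, Finset.mem_ssubsets,
    hitsEq, exists_prop]
  have h : (∃ i < n, τ i ∉ N) ↔ hits N n τ ⊂ Finset.range n := by
    rw [Finset.ssubset_iff_of_subset fun i hi => Finset.mem_range.2 (mem_hits.1 hi).1]
    refine exists_congr fun i => ?_
    rw [mem_hits, Finset.mem_range]
    tauto
  rw [h]
  constructor
  · rintro ⟨h1, h2, h3⟩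
    exact ⟨_, ⟨h1, h2⟩, rfl, h3⟩
  · rintro ⟨_, ⟨h1, h2⟩, rfl, h3⟩
    exact ⟨h1, h2, h3⟩

include hN hC in
theorem measurableSet_hitsIn (R : Set ℕ) (n : ℕ) : MeasurableSet (hitsIn N C R n) := by
  classical
  rw [hitsIn_eq_biUnion]
  refine Finset.measurableSet_biUnion _ fun K hK => measurableSet_hitsEq hN hC n ?_
  exact (Finset.mem_ssubsets.1 (Finset.mem_filter.1 hK).1).subset

include hN hC in
theorem infinitePi_hitsIn (R : Set ℕ) (n : ℕ) :
    Measure.infinitePi (fun _ : ℕ => ν) (hitsIn N C R n) =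
      ∑ K ∈ (Finset.range n).ssubsets, ν Nᶜ ^ (n - K.card) *
        (∏ k ∈ Finset.range K.card, ν (N ∩ C k)) * R.indicator 1 K.card := by
  classical
  have hs : ∀ K ∈ (Finset.range n).ssubsets.filter (fun K => K.card ∈ R), K ⊆ Finset.range n :=
    fun K hK => (Finset.mem_ssubsets.1 (Finset.mem_filter.1 hK).1).subset
  rw [hitsIn_eq_biUnion, measure_biUnion_finset _
    fun K hK => measurableSet_hitsEq hN hC n (hs K hK), Finset.sum_filter]
  · refine Finset.sum_congr rfl fun K hK => ?_
    split_ifs with h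
    · rw [infinitePi_hitsEq ν hN hC n (Finset.mem_ssubsets.1 hK).subset,
        Set.indicator_of_mem h, Pi.one_apply, mul_one]
    · rw [Set.indicator_of_notMem h, mul_zero]
  · intro K _ L _ hKL
    exact Set.disjoint_left.2 fun τ h h' => hKL (h.1.symm.trans h'.1)

end Trials

/-! ### The branching property -/

/-- The law of the family sizes of all potential individuals. -/
noncomputable abbrev familySizeLaw (p : PMF ℕ) : Measure (List ℕ → ℕ) :=
  Measure.infinitePi fun _ : List ℕ => p.toMeasure

/-- The family size of the root, and the family sizes in the subtrees of its potential children. -/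
def branch (ξ : List ℕ → ℕ) : ℕ × (ℕ → List ℕ → ℕ) := (ξ [], fun i u => ξ (i :: u))

/-- The inverse of `branch`. -/
def graft (x : ℕ × (ℕ → List ℕ → ℕ)) : List ℕ → ℕ
  | [] => x.1
  | i :: u => x.2 i u

theorem measurable_branch : Measurable branch := by
  unfold branch
  fun_prop

theorem measurable_graft : Measurable graft := by
  refine measurable_pi_lambda _ fun u => ?_
  cases u with
  | nil => exact measurable_fst
  | cons i u => exact (measurable_pi_apply u).comp ((measurable_pi_apply i).comp measurable_snd)

/-- A nonempty word is a pair of first letter and remainder, so the sizes away from the root form a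
product over pairs, which is curried. The identity is checked on finite boxes. -/
theorem map_graft (p : PMF ℕ) :
    (p.toMeasure.prod (Measure.infinitePi fun _ : ℕ => familySizeLaw p)).map graft =
      familySizeLaw p := by
  classical
  refine Measure.eq_infinitePi _ fun s t ht => ?_
  let s' : Finset (ℕ × List ℕ) :=
    s.preimage (fun x => x.1 :: x.2) fun x _ y _ h => by
      simpa [Prod.ext_iff] using h
  have hs' : ∀ x, x ∈ s' ↔ x.1 :: x.2 ∈ s := fun x =>
    Finset.mem_preimage (f := fun x : ℕ × List ℕ => x.1 :: x.2)
  have hcurry : (Measure.infinitePi fun _ : ℕ => familySizeLaw p) =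
      (Measure.infinitePi fun _ : ℕ × List ℕ => p.toMeasure).map
        (MeasurableEquiv.curry ℕ (List ℕ) ℕ) :=
    (Measure.infinitePi_map_curry (ι := ℕ) (κ := List ℕ) fun _ _ => p.toMeasure).symm
  have hpre : graft ⁻¹' Set.pi s t =
      {n | [] ∈ s → n ∈ t []} ×ˢ
        ((MeasurableEquiv.curry ℕ (List ℕ) ℕ).symm ⁻¹' Set.pi s' fun x => t (x.1 :: x.2)) := by
    ext ⟨n, τ⟩
    simp only [Set.mem_preimage, Set.mem_pi, Set.mem_prod, Set.mem_ofPred_eq, Finset.mem_coe]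
    constructor
    · exact fun h => ⟨fun h0 => h [] h0, fun x hx => h (x.1 :: x.2) (hs' x |>.1 hx)⟩
    · rintro ⟨h0, h1⟩ w hw
      cases w with
      | nil => exact h0 hw
      | cons i u => exact h1 (i, u) ((hs' (i, u)).2 hw)
  have hs : (∏ x ∈ s', p.toMeasure (t (x.1 :: x.2))) =
      ∏ w ∈ s.erase [], p.toMeasure (t w) := by
    refine Finset.prod_nbij (fun x => x.1 :: x.2) ?_ ?_ ?_ fun _ _ => rfl
    · intro x hx
      simpa using (hs' x).1 hx
    · rintro x - y - h
      simpa [Prod.ext_iff] using h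
    · intro w hw
      cases w with
      | nil => simp at hw
      | cons i u => exact ⟨(i, u), (hs' (i, u)).2 (Finset.mem_of_mem_erase hw), rfl⟩
  rw [Measure.map_apply measurable_graft
    (MeasurableSet.pi (Finset.countable_toSet s) fun i hi => ht i), hpre, Measure.prod_prod, hcurry,
    MeasurableEquiv.map_apply, ← Set.preimage_comp]
  rw [MeasurableEquiv.symm_comp_self, Set.preimage_id, Measure.infinitePi_pi _ fun x _ => ht _, hs]
  by_cases h0 : [] ∈ s
  · simp only [h0, true_imp_iff, Set.ofPred_mem_eq]
    rw [Finset.mul_prod_erase s (fun w => p.toMeasure (t w)) h0]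
  · simp [h0]

theorem measurePreserving_branch (p : PMF ℕ) :
    MeasurePreserving branch (familySizeLaw p)
      (p.toMeasure.prod (Measure.infinitePi fun _ : ℕ => familySizeLaw p)) := by
  refine ⟨measurable_branch, ?_⟩
  -- `branch` undoes `graft` definitionally, so pushing forward along both is the identity.
  conv_lhs => rw [← map_graft]
  rw [Measure.map_map measurable_branch measurable_graft]
  exact Measure.map_id

theorem prod_iUnion_singleton {E : Type*} [MeasurableSpace E] (p : PMF ℕ) (M : Measure E)
    [SFinite M] {B : ℕ → Set E} (hB : ∀ n, MeasurableSet (B n)) :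
    MeasurableSet {x : ℕ × E | x.2 ∈ B x.1} ∧
      p.toMeasure.prod M {x : ℕ × E | x.2 ∈ B x.1} = ∑' n, p n * M (B n) := by
  have h : {x : ℕ × E | x.2 ∈ B x.1} = ⋃ n, {n} ×ˢ B n := by
    ext ⟨n, e⟩
    simp
  have hm : ∀ n : ℕ, MeasurableSet (({n} : Set ℕ) ×ˢ B n) :=
    fun n => (measurableSet_singleton n).prod (hB n)
  refine ⟨h ▸ MeasurableSet.iUnion hm, ?_⟩
  rw [h, measure_iUnion _ hm]
  · refine tsum_congr fun n => ?_
    rw [Measure.prod_prod, p.toMeasure_apply_singleton _ (measurableSet_singleton n)]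
  · intro m n hmn
    refine Set.disjoint_left.2 fun x hx hx' => hmn ?_
    exact (Set.mem_singleton_iff.1 hx.1).symm.trans (Set.mem_singleton_iff.1 hx'.1)

/-! ### First-generation decompositions of finite sets of words -/

/-- The words which, preceded by `k`, are in `S`. -/
noncomputable def tails (S : Finset (List ℕ)) (k : ℕ) : Finset (List ℕ) :=
  S.preimage (List.cons k) fun _ _ _ _ h => List.cons_injective h

@[simp] theorem mem_tails {S : Finset (List ℕ)} {k : ℕ} {u : List ℕ} :
    u ∈ tails S k ↔ k :: u ∈ S := Finset.mem_preimage

/-- The least strict upper bound for the first letters of the words in `S`. -/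
def headBound (S : Finset (List ℕ)) : ℕ := S.sup fun w => w.head?.elim 0 (· + 1)

theorem headBound_le_iff {S : Finset (List ℕ)} {c : ℕ} :
    headBound S ≤ c ↔ ∀ k u, k :: u ∈ S → k < c := by
  rw [headBound, Finset.sup_le_iff]
  constructor
  · exact fun h k u hu => h _ hu
  · intro h w hw
    cases w with
    | nil => exact Nat.zero_le _
    | cons k u => exact h k u hw

theorem tails_eq_empty {S : Finset (List ℕ)} {k : ℕ} (h : headBound S ≤ k) : tails S k = ∅ := by
  refine Finset.eq_empty_of_forall_notMem fun u hu => ?_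
  exact lt_irrefl k (headBound_le_iff.1 h k u (mem_tails.1 hu))

/-- Children beyond `headBound S` carry no constraint, so the product is the same for every
sufficiently large number of children. -/
theorem prod_tails {M : Type*} [CommMonoid M] (S : Finset (List ℕ)) {g : Finset (List ℕ) → M}
    (hg : g ∅ = 1) {c : ℕ} (hc : headBound S ≤ c) :
    ∏ k ∈ Finset.range c, g (tails S k) = ∏ k ∈ Finset.range (headBound S), g (tails S k) := by
  refine (Finset.prod_subset (by simpa using hc) fun k _ hk => ?_).symm
  rw [tails_eq_empty (by simpa using hk), hg]

/-- The trees that contain all the words in `S`. -/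
def containing (S : Finset (List ℕ)) : Set (Set (List ℕ)) := {t | ∀ w ∈ S, w ∈ t}

theorem measurableSet_containing (S : Finset (List ℕ)) : MeasurableSet (containing S) :=
  measurableSet_setOfPred.2 <| Measurable.forall fun w => measurable_const.imp
    (measurable_word_mem w)

theorem containing_empty : containing ∅ = Set.univ := by
  ext t
  simp [containing]

/-- These events form a π-system, intersections corresponding to unions of `S`, and those with
singleton `S` generate the σ-algebra. -/
theorem ext_of_containing {μ ν : Measure (Set (List ℕ))} [IsProbabilityMeasure μ]
    [IsProbabilityMeasure ν] (h : ∀ S, μ (containing S) = ν (containing S)) : μ = ν := by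
  classical
  refine ext_of_generate_finite (Set.range containing) ?_ ?_ ?_ (by simp)
  · refine le_antisymm ?_ (MeasurableSpace.generateFrom_le ?_)
    · have : @Measurable _ _ (MeasurableSpace.generateFrom (Set.range containing)) inferInstance
          (id : Set (List ℕ) → Set (List ℕ)) := by
        refine (@measurable_set_iff _ _ (MeasurableSpace.generateFrom (Set.range containing))
          _).2 fun w => (@measurableSet_setOfPred _
            (MeasurableSpace.generateFrom (Set.range containing)) _).1 ?_
        refine MeasurableSpace.measurableSet_generateFrom ⟨{w}, ?_⟩
        ext t
        simp [containing]
      exact fun s hs => this hs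
    · rintro _ ⟨S, rfl⟩
      exact measurableSet_containing S
  · rintro _ ⟨S, rfl⟩ _ ⟨S', rfl⟩ -
    refine ⟨S ∪ S', ?_⟩
    ext t
    simp only [containing, Finset.mem_union, Set.mem_inter_iff, Set.mem_ofPred_eq]
    exact ⟨fun h => ⟨fun w hw => h w (.inl hw), fun w hw => h w (.inr hw)⟩,
      fun h w hw => hw.elim (h.1 w) (h.2 w)⟩
  · rintro _ ⟨S, rfl⟩
    exact h S

/-! ### First-generation decomposition of the family tree -/

theorem cons_mem_familyTree {ξ : List ℕ → ℕ} {i : ℕ} {u : List ℕ} :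
    i :: u ∈ familyTree ξ ↔ i < ξ [] ∧ u ∈ familyTree ((branch ξ).2 i) := by
  constructor
  · intro h
    refine ⟨h [] i (by simp), fun v j hv => h (i :: v) j ?_⟩
    simpa using hv
  · rintro ⟨hi, hu⟩ v j hv
    cases v with
    | nil =>
      obtain rfl : j = i := by simpa using hv
      exact hi
    | cons k v =>
      rw [List.cons_append, List.cons_prefix_cons] at hv
      obtain ⟨rfl, hv⟩ := hv
      exact hu v j hv

theorem subtree_familyTree {ξ : List ℕ → ℕ} {i : ℕ} (hi : i < ξ []) :
    subtree (familyTree ξ) [i] = familyTree ((branch ξ).2 i) := by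
  ext u
  simp [cons_mem_familyTree, hi]

/-- The family sizes for which the root is winning for the player to move. -/
def winSet : Set (List ℕ → ℕ) := {ξ | Win (familyTree ξ)}

theorem measurableSet_winSet : MeasurableSet winSet :=
  measurableSet_setOfPred.2 (measurable_win.comp measurable_familyTree)

/-- The children of the root that are winning for the player to move. -/
noncomputable def winningChildren (ξ : List ℕ → ℕ) : Finset ℕ := hits winSet (ξ []) (branch ξ).2

theorem lt_of_mem_winningChildren {ξ : List ℕ → ℕ} {i : ℕ} (hi : i ∈ winningChildren ξ) :
    i < ξ [] := (mem_hits.1 hi).1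

theorem winningChild_iff {ξ : List ℕ → ℕ} {i : ℕ} :
    WinningChild (familyTree ξ) i ↔ i ∈ winningChildren ξ := by
  rw [winningChildren, mem_hits, WinningChild, cons_mem_familyTree,
    and_iff_left (isLocallyFiniteTree_familyTree _).nil_mem]
  refine and_congr_right fun hi => ?_
  rw [subtree_familyTree hi]
  rfl

open Classical in
theorem count_winningChild (ξ : List ℕ → ℕ) (i : ℕ) :
    Nat.count (WinningChild (familyTree ξ)) i = (winningChildren ξ).rankOf i := by
  rw [Nat.count_eq_card_filter_range, Finset.rankOf]
  congr 1
  ext j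
  simp [winningChild_iff, and_comm]

theorem win_familyTree_iff {ξ : List ℕ → ℕ} (hd : NoDraw (familyTree ξ)) :
    Win (familyTree ξ) ↔ ∃ i < ξ [], (branch ξ).2 i ∉ winSet := by
  have h := not_win_iff (isLocallyFiniteTree_familyTree ξ) hd
    (isLocallyFiniteTree_familyTree ξ).nil_mem
  rw [subtree_nil] at h
  rw [← not_iff_not, h]
  push Not
  refine forall_congr' fun i => ?_
  rw [List.nil_append, cons_mem_familyTree,
    and_iff_left (isLocallyFiniteTree_familyTree _).nil_mem]
  refine imp_congr_right fun hi => ?_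
  rw [subtree_familyTree hi]
  rfl

theorem cons_mem_reduce_familyTree {ξ : List ℕ → ℕ} {k : ℕ} {u : List ℕ} :
    k :: u ∈ reduce (familyTree ξ) ↔ ∃ i ∈ winningChildren ξ, (winningChildren ξ).rankOf i = k ∧
      u ∈ reduce (familyTree ((branch ξ).2 i)) := by
  change (∃ i, _ ∧ _ ∧ MemReduce u _) ↔ _
  refine exists_congr fun i => ?_
  rw [winningChild_iff]
  refine and_congr_right fun hi => ?_
  rw [count_winningChild, subtree_familyTree (lt_of_mem_winningChildren hi)]
  rfl

/-- Ranks map the winning children bijectively onto an initial segment, so the `k`-th child in the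
reduced tree is the winning child of rank `k`. -/
theorem reduce_mem_containing_iff {ξ : List ℕ → ℕ} {S : Finset (List ℕ)} :
    reduce (familyTree ξ) ∈ containing S ↔ headBound S ≤ (winningChildren ξ).card ∧
      ∀ i ∈ winningChildren ξ, reduce (familyTree ((branch ξ).2 i)) ∈
        containing (tails S ((winningChildren ξ).rankOf i)) := by
  constructor
  · intro h
    refine ⟨headBound_le_iff.2 fun k u hu => ?_, fun i hi u hu => ?_⟩
    · obtain ⟨i, hi, rfl, -⟩ := cons_mem_reduce_familyTree.1 (h _ hu)
      exact Finset.rankOf_lt_card hi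
    · obtain ⟨j, hj, hij, h⟩ := cons_mem_reduce_familyTree.1 (h _ (mem_tails.1 hu))
      rwa [(winningChildren ξ).rankOf_strictMonoOn.injOn hj hi hij] at h
  · rintro ⟨h1, h2⟩ w hw
    cases w with
    | nil => exact trivial
    | cons k u =>
      have hk := Finset.mem_range.2 (headBound_le_iff.1 h1 k u hw)
      rw [← Finset.image_rankOf, Finset.mem_image] at hk
      obtain ⟨i, hi, rfl⟩ := hk
      exact cons_mem_reduce_familyTree.2 ⟨i, hi, rfl, h2 i hi u (mem_tails.2 hw)⟩

theorem familyTree_mem_containing_iff {ξ : List ℕ → ℕ} {S : Finset (List ℕ)} :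
    familyTree ξ ∈ containing S ↔ headBound S ≤ ξ [] ∧
      ∀ k < headBound S, familyTree ((branch ξ).2 k) ∈ containing (tails S k) := by
  constructor
  · intro h
    exact ⟨headBound_le_iff.2 fun k u hu => (cons_mem_familyTree.1 (h _ hu)).1,
      fun k _ u hu => (cons_mem_familyTree.1 (h _ (mem_tails.1 hu))).2⟩
  · rintro ⟨h1, h2⟩ w hw
    cases w with
    | nil => exact (isLocallyFiniteTree_familyTree _).nil_mem
    | cons k u =>
      exact cons_mem_familyTree.2 ⟨headBound_le_iff.1 h1 k u hw,
        h2 k (headBound_le_iff.1 le_rfl k u hw) u (mem_tails.2 hw)⟩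

/-! ### Laws -/

/-- The family sizes for which the reduced tree contains all the words in `S`. -/
def reducedContaining (S : Finset (List ℕ)) : Set (List ℕ → ℕ) :=
  {ξ | reduce (familyTree ξ) ∈ containing S}

theorem measurableSet_reducedContaining (S : Finset (List ℕ)) :
    MeasurableSet (reducedContaining S) :=
  (measurable_reduce.comp measurable_familyTree) (measurableSet_containing S)

theorem reducedContaining_empty : reducedContaining ∅ = Set.univ := by
  simp [reducedContaining, containing_empty]

/-- Condition on the root's family size. Winning children are the hits; by draw-freeness the root
wins when not every child is a hit, so `K` runs over proper subsets. -/
theorem familySizeLaw_win_inter (p : PMF ℕ)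
    (hd : ∀ᵐ ξ ∂familySizeLaw p, NoDraw (familyTree ξ)) (S : Finset (List ℕ)) :
    familySizeLaw p (winSet ∩ reducedContaining S) =
      ∑' n, p n * ∑ K ∈ (Finset.range n).ssubsets, familySizeLaw p winSetᶜ ^ (n - K.card) *
        (∏ k ∈ Finset.range K.card, familySizeLaw p (winSet ∩ reducedContaining (tails S k))) *
          (Set.Ici (headBound S)).indicator 1 K.card := by
  have hB := measurableSet_hitsIn measurableSet_winSet
    (C := fun k => reducedContaining (tails S k)) (fun k => measurableSet_reducedContaining _)
    (Set.Ici (headBound S))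
  obtain ⟨h1, h2⟩ := prod_iUnion_singleton p
    (Measure.infinitePi fun _ : ℕ => familySizeLaw p) hB
  rw [← (measurePreserving_branch p).measure_preimage h1.nullMeasurableSet] at h2
  simp only [← infinitePi_hitsIn (familySizeLaw p) measurableSet_winSet
    (C := fun k => reducedContaining (tails S k)) (fun k => measurableSet_reducedContaining _)]
  rw [← h2]
  refine measure_congr ?_
  filter_upwards [hd] with ξ hξ
  refine propext ?_
  change Win (familyTree ξ) ∧ reduce (familyTree ξ) ∈ containing S ↔ _
  rw [win_familyTree_iff hξ, reduce_mem_containing_iff]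
  rfl

theorem familySizeLaw_containing (p : PMF ℕ) (S : Finset (List ℕ)) :
    familySizeLaw p {ξ | familyTree ξ ∈ containing S} =
      p.toMeasure (Set.Ici (headBound S)) * ∏ k ∈ Finset.range (headBound S),
        familySizeLaw p {ξ | familyTree ξ ∈ containing (tails S k)} := by
  have hm : ∀ S, MeasurableSet {ξ | familyTree ξ ∈ containing S} :=
    fun S => measurable_familyTree (measurableSet_containing S)
  have h : {ξ | familyTree ξ ∈ containing S} = branch ⁻¹' (Set.Ici (headBound S) ×ˢ
      Set.pi (Finset.range (headBound S)) fun k => {ξ | familyTree ξ ∈ containing (tails S k)}) := by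
    ext ξ
    rw [Set.mem_ofPred_eq, familyTree_mem_containing_iff]
    simp [branch]
  rw [h, (measurePreserving_branch p).measure_preimage, Measure.prod_prod,
    Measure.infinitePi_pi _ fun k _ => hm _]
  exact (measurableSet_Ici.prod (MeasurableSet.pi (Finset.countable_toSet _)
    fun k _ => hm _)).nullMeasurableSet

/-- `q⁻¹` times the probability that `k` children are of the first kind and at
least one is of the second kind, when each child is independently of the first kind with
probability `q` and of the second kind with probability `r`. -/
noncomputable def thinnedOffspring (p : PMF ℕ) (q r : ℝ≥0∞) (k : ℕ) : ℝ≥0∞ :=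
  q⁻¹ * ∑' n, p n * ∑ K ∈ (Finset.range n).ssubsets,
    if K.card = k then r ^ (n - K.card) * q ^ K.card else 0

theorem tsum_thinnedOffspring_mul (p : PMF ℕ) {q : ℝ≥0∞} (hq : q ≠ 0) (hq' : q ≠ ∞) (r : ℝ≥0∞)
    (f : ℕ → ℝ≥0∞) :
    q * ∑' k, thinnedOffspring p q r k * f k =
      ∑' n, p n * ∑ K ∈ (Finset.range n).ssubsets, r ^ (n - K.card) * q ^ K.card * f K.card := by
  have h : ∀ k, q * (thinnedOffspring p q r k * f k) = ∑' n, p n *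
      ∑ K ∈ (Finset.range n).ssubsets,
        if K.card = k then r ^ (n - K.card) * q ^ K.card * f K.card else 0 := by
    intro k
    rw [thinnedOffspring, mul_assoc, ENNReal.mul_inv_cancel_left hq hq', ← ENNReal.tsum_mul_right]
    refine tsum_congr fun n => ?_
    rw [mul_assoc, Finset.sum_mul]
    congr 1
    refine Finset.sum_congr rfl fun K _ => ?_
    split_ifs with hK
    · rw [hK]
    · rw [zero_mul]
  rw [← ENNReal.tsum_mul_left]
  simp only [h]
  rw [ENNReal.tsum_comm]
  refine tsum_congr fun n => ?_
  rw [ENNReal.tsum_mul_left, Summable.tsum_finsetSum fun _ _ => ENNReal.summable]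
  congr 1
  refine Finset.sum_congr rfl fun K _ => ?_
  rw [tsum_eq_single K.card fun k hk => if_neg hk.symm, if_pos rfl]

/-! ### Offspring distribution and law of the reduced tree -/

section ReducedLaw

variable {p : PMF ℕ} (hd : ∀ᵐ ξ ∂familySizeLaw p, NoDraw (familyTree ξ))

include hd

/-- The case `S = ∅` of the recursion; it says that the thinned offspring weights have total mass
one. -/
theorem familySizeLaw_winSet :
    familySizeLaw p winSet = ∑' n, p n * ∑ K ∈ (Finset.range n).ssubsets,
      familySizeLaw p winSetᶜ ^ (n - K.card) * familySizeLaw p winSet ^ K.card := by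
  have h := familySizeLaw_win_inter p hd ∅
  have h0 : headBound ∅ = 0 := rfl
  have h1 : ∀ k, tails ∅ k = ∅ := fun k => tails_eq_empty (Nat.zero_le k)
  simpa [reducedContaining_empty, h0, h1] using h

/-- If nobody ever wins, every child is a non-hit, and the term `K = ∅` forces `p n = 0` for all `n
≠ 0`. -/
theorem familySizeLaw_winSet_ne_zero (hp : p 0 < 1) : familySizeLaw p winSet ≠ 0 := by
  intro hq
  have h := familySizeLaw_winSet hd
  rw [prob_compl_eq_one_sub measurableSet_winSet, hq] at h
  have h' := ENNReal.tsum_eq_zero.1 h.symm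
  have hn : ∀ n, n ≠ 0 → p n = 0 := by
    intro n hn0
    have hmem : ∅ ∈ (Finset.range n).ssubsets := by
      rw [Finset.mem_ssubsets, Finset.empty_ssubset]
      simpa using hn0
    refine (mul_eq_zero.1 (h' n)).resolve_right fun h0 => ?_
    simpa using Finset.sum_eq_zero_iff.1 h0 ∅ hmem
  exact hp.ne (by rw [← p.tsum_coe, tsum_eq_single 0 hn])

theorem hasSum_thinnedOffspring (hp : p 0 < 1) :
    HasSum (thinnedOffspring p (familySizeLaw p winSet) (familySizeLaw p winSetᶜ)) 1 := by
  have hq := familySizeLaw_winSet_ne_zero hd hp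
  have hq' := measure_ne_top (familySizeLaw p) winSet
  have h := tsum_thinnedOffspring_mul p hq hq' (familySizeLaw p winSetᶜ) fun _ => 1
  simp only [mul_one] at h
  rw [← familySizeLaw_winSet hd] at h
  have : ∑' k, thinnedOffspring p (familySizeLaw p winSet) (familySizeLaw p winSetᶜ) k = 1 := by
    rwa [ENNReal.mul_eq_left hq hq'] at h
  exact this ▸ ENNReal.summable.hasSum

/-- The offspring distribution of the reduced tree. -/
noncomputable def reducedOffspring (hp : p 0 < 1) : PMF ℕ :=
  ⟨thinnedOffspring p (familySizeLaw p winSet) (familySizeLaw p winSetᶜ),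
    hasSum_thinnedOffspring hd hp⟩

theorem tsum_reducedOffspring_mul (hp : p 0 < 1) (f : ℕ → ℝ≥0∞) :
    familySizeLaw p winSet * ∑' k, reducedOffspring hd hp k * f k =
      ∑' n, p n * ∑ K ∈ (Finset.range n).ssubsets,
        familySizeLaw p winSetᶜ ^ (n - K.card) * familySizeLaw p winSet ^ K.card * f K.card :=
  tsum_thinnedOffspring_mul p (familySizeLaw_winSet_ne_zero hd hp) (measure_ne_top _ _) _ f

/-- Both sides obey the same first-generation recursion, and passing to `tails` shortens the words;
hence induction on a bound for their length. -/
theorem familySizeLaw_win_inter_reducedContaining (hp : p 0 < 1) (S : Finset (List ℕ)) :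
    familySizeLaw p (winSet ∩ reducedContaining S) = familySizeLaw p winSet *
      familySizeLaw (reducedOffspring hd hp) {ξ | familyTree ξ ∈ containing S} := by
  suffices ∀ d (S : Finset (List ℕ)), (∀ w ∈ S, w.length < d) →
      familySizeLaw p (winSet ∩ reducedContaining S) = familySizeLaw p winSet *
        familySizeLaw (reducedOffspring hd hp) {ξ | familyTree ξ ∈ containing S} from
    this (S.sup List.length + 1) S fun w hw => Nat.lt_succ_of_le (Finset.le_sup hw)
  intro d
  induction d with
  | zero =>
    intro S hS
    obtain rfl : S = ∅ := Finset.eq_empty_of_forall_notMem fun w hw => Nat.not_lt_zero _ (hS w hw)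
    simp [reducedContaining_empty, containing_empty]
  | succ d ih =>
    intro S hS
    have ih' : ∀ k, familySizeLaw p (winSet ∩ reducedContaining (tails S k)) = _ := fun k =>
      ih (tails S k) fun w hw => by simpa using hS _ (mem_tails.1 hw)
    have hR : (reducedOffspring hd hp).toMeasure (Set.Ici (headBound S)) =
        ∑' k, reducedOffspring hd hp k * (Set.Ici (headBound S)).indicator 1 k := by
      rw [PMF.toMeasure_apply _ measurableSet_Ici]
      refine tsum_congr fun k => ?_
      by_cases hk : k ∈ Set.Ici (headBound S) <;> simp [hk, Set.indicator]
    rw [familySizeLaw_win_inter p hd, familySizeLaw_containing, hR, ← mul_assoc,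
      tsum_reducedOffspring_mul, ← ENNReal.tsum_mul_right]
    refine tsum_congr fun n => ?_
    rw [mul_assoc, Finset.sum_mul]
    congr 1
    refine Finset.sum_congr rfl fun K _ => ?_
    by_cases hK : K.card ∈ Set.Ici (headBound S)
    -- Each surviving child contributes a factor `familySizeLaw p winSet` through `ih'`; together
    -- they supply the power of it in the offspring weights.
    · simp only [ih', Finset.prod_mul_distrib, Finset.prod_const, Finset.card_range]
      rw [prod_tails S (g := fun S => familySizeLaw (reducedOffspring hd hp)
        {ξ | familyTree ξ ∈ containing S}) (by simp [containing_empty]) hK]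
      simp only [Set.indicator_of_mem hK, Pi.one_apply, mul_one, mul_assoc]
    · simp [Set.indicator_of_notMem hK]

end ReducedLaw

/-! ### The probability generating function -/

theorem offspringPGF_eq_toReal (p : PMF ℕ) {s : ℝ} (hs : 0 ≤ s) :
    offspringPGF p s = (∑' n, p n * ENNReal.ofReal s ^ n).toReal := by
  rw [ENNReal.tsum_toReal_eq fun n => ENNReal.mul_ne_top (p.apply_ne_top n)
    (ENNReal.pow_ne_top ENNReal.ofReal_ne_top)]
  refine tsum_congr fun n => ?_
  rw [ENNReal.toReal_mul, ENNReal.toReal_pow, ENNReal.toReal_ofReal hs]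

theorem tsum_mul_pow_ne_top (p : PMF ℕ) {x : ℝ≥0∞} (hx : x ≤ 1) : ∑' n, p n * x ^ n ≠ ∞ := by
  refine ne_top_of_le_ne_top ENNReal.one_ne_top ?_
  rw [← p.tsum_coe]
  exact ENNReal.tsum_le_tsum fun n => mul_le_of_le_one_right' (pow_le_one₀ zero_le hx)

section ReducedLaw

variable {p : PMF ℕ} (hd : ∀ᵐ ξ ∂familySizeLaw p, NoDraw (familyTree ξ))

/-- The binomial theorem as a sum over all subsets: the second series on the left is the
contribution of the full set. The additive form avoids truncated subtraction in `ℝ≥0∞`. -/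
theorem tsum_reducedOffspring_mul_pow (hp : p 0 < 1) (x : ℝ≥0∞) :
    familySizeLaw p winSet * ∑' k, reducedOffspring hd hp k * x ^ k +
        ∑' n, p n * (familySizeLaw p winSet * x) ^ n =
      ∑' n, p n * (familySizeLaw p winSetᶜ + familySizeLaw p winSet * x) ^ n := by
  rw [tsum_reducedOffspring_mul, ← ENNReal.tsum_add]
  refine tsum_congr fun n => ?_
  rw [← mul_add]
  congr 1
  have h := Finset.sum_pow_mul_eq_add_pow (familySizeLaw p winSet * x)
    (familySizeLaw p winSetᶜ) (Finset.range n)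
  rw [Finset.card_range, add_comm (familySizeLaw p winSet * x)] at h
  rw [← h, ← Finset.sum_erase_add _ _ (Finset.mem_powerset_self _), Finset.card_range,
    Nat.sub_self, pow_zero, mul_one]
  congr 1
  refine Finset.sum_congr rfl fun K _ => ?_
  rw [mul_pow]
  ring

theorem offspringPGF_reducedOffspring (hp : p 0 < 1) {P : ℝ}
    (hP : P = (familySizeLaw p).real winSetᶜ) {s : ℝ} (hs : s ∈ Set.Icc (0 : ℝ) 1) :
    offspringPGF (reducedOffspring hd hp) s =
      1 / (1 - P) * (offspringPGF p (P + s * (1 - P)) - offspringPGF p (s * (1 - P))) := by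
  have hq : 1 - P = (familySizeLaw p).real winSet := by
    rw [hP, probReal_compl_eq_one_sub measurableSet_winSet, sub_sub_cancel]
  have hP0 : 0 ≤ P := hP ▸ measureReal_nonneg
  have hq0 : 0 < 1 - P := by
    rw [hq]
    exact ENNReal.toReal_pos (familySizeLaw_winSet_ne_zero hd hp) (measure_ne_top _ _)
  have h1 : ENNReal.ofReal (s * (1 - P)) = familySizeLaw p winSet * ENNReal.ofReal s := by
    rw [ENNReal.ofReal_mul hs.1, hq, ofReal_measureReal, mul_comm]
  have h2 : ENNReal.ofReal (P + s * (1 - P)) =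
      familySizeLaw p winSetᶜ + familySizeLaw p winSet * ENNReal.ofReal s := by
    rw [ENNReal.ofReal_add hP0 (mul_nonneg hs.1 hq0.le), h1, hP, ofReal_measureReal]
  have hle : P + s * (1 - P) ≤ 1 := by nlinarith [hs.2]
  have h := congrArg ENNReal.toReal (tsum_reducedOffspring_mul_pow hd hp (ENNReal.ofReal s))
  rw [ENNReal.toReal_add, ENNReal.toReal_mul, ← h2, ← h1, ← offspringPGF_eq_toReal _ hs.1,
    ← offspringPGF_eq_toReal _ (mul_nonneg hs.1 hq0.le),
    ← offspringPGF_eq_toReal _ (add_nonneg hP0 (mul_nonneg hs.1 hq0.le))] at h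
  · change (familySizeLaw p).real winSet * _ + _ = _ at h
    rw [← hq] at h
    rw [← h, add_sub_cancel_right]
    field_simp
  · exact ENNReal.mul_ne_top (measure_ne_top _ _)
      (tsum_mul_pow_ne_top _ (ENNReal.ofReal_le_one.2 hs.2))
  · rw [← h1]
    exact tsum_mul_pow_ne_top _ (ENNReal.ofReal_le_one.2 (by linarith))

/-! ### The law of the reduced tree -/

theorem measurableSet_setOf_win : MeasurableSet {t | Win t} :=
  measurableSet_setOfPred.2 measurable_win

theorem galtonWatsonLaw_win (p : PMF ℕ) :
    galtonWatsonLaw p {t | Win t} = familySizeLaw p winSet :=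
  Measure.map_apply measurable_familyTree measurableSet_setOf_win

theorem map_reduce_cond_galtonWatsonLaw (hp : p 0 < 1) :
    (galtonWatsonLaw p)[|{t | Win t}].map reduce = galtonWatsonLaw (reducedOffspring hd hp) := by
  have hq : galtonWatsonLaw p {t | Win t} ≠ 0 :=
    galtonWatsonLaw_win p ▸ familySizeLaw_winSet_ne_zero hd hp
  have := cond_isProbabilityMeasure hq
  have := Measure.isProbabilityMeasure_map
    (μ := (galtonWatsonLaw p)[|{t | Win t}]) measurable_reduce.aemeasurable
  refine ext_of_containing fun S => ?_
  have hS := measurableSet_containing S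
  rw [Measure.map_apply measurable_reduce hS, cond_apply measurableSet_setOf_win,
    galtonWatsonLaw_win, galtonWatsonLaw, galtonWatsonLaw,
    Measure.map_apply measurable_familyTree hS,
    Measure.map_apply measurable_familyTree (measurableSet_setOf_win.inter (measurable_reduce hS))]
  change _ * familySizeLaw p (winSet ∩ reducedContaining S) = _
  rw [familySizeLaw_win_inter_reducedContaining hd hp,
    ENNReal.inv_mul_cancel_left (familySizeLaw_winSet_ne_zero hd hp) (measure_ne_top _ _)]
  rfl

end ReducedLaw

/-- The event `A` need only agree almost everywhere with a preimage, since the event that the root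
is an `N`-position is not known to be measurable in `Ω`. -/
theorem ProbabilityTheory.HasLaw.cond {Ω E : Type*} [MeasurableSpace Ω] [MeasurableSpace E]
    {μ : Measure Ω} {ν : Measure E} {X : Ω → E} (hX : HasLaw X ν μ) {A : Set Ω} {B : Set E}
    (hB : MeasurableSet B) (hA : A =ᵐ[μ] X ⁻¹' B) : HasLaw X ν[|B] μ[|A] where
  aemeasurable := hX.aemeasurable.mono_ac cond_absolutelyContinuous
  map_eq := by
    rw [ProbabilityTheory.cond, ProbabilityTheory.cond, Measure.map_smul,
      Measure.restrict_congr_set hA, measure_congr hA, ← hX.map_eq,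
      Measure.map_apply_of_aemeasurable hX.aemeasurable hB]
    congr 1
    exact (Measure.restrict_map_of_aemeasurable hX.aemeasurable hB).symm

theorem ae_isLocallyFiniteTree (p : PMF ℕ) :
    ∀ᵐ t ∂galtonWatsonLaw p, IsLocallyFiniteTree t :=
  (ae_map_iff measurable_familyTree.aemeasurable measurableSet_isLocallyFiniteTree).2
    (ae_of_all _ isLocallyFiniteTree_familyTree)

theorem mainTheorem4 {Ω V : Type*} [MeasurableSpace Ω] (μ : Measure Ω) [IsProbabilityMeasure μ]
    (p : PMF ℕ) (hp : p 0 < 1) (T : Ω → RootedDigraph V) (hT : IsGaltonWatsonTree p μ T)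
    (hdraw : ∀ᵐ ω ∂μ, (T ω).IsDrawFree)
    (P : ℝ) (hP : P = μ.real {ω | (T ω).root ∈ (T ω).pPositions}) :
    ∃ p₁ : PMF ℕ,
      IsGaltonWatsonTree p₁ (μ[|{ω | (T ω).root ∈ (T ω).nPositions}])
        (fun ω => (T ω).reducedComponent) ∧
      ∀ s ∈ Set.Icc (0 : ℝ) 1,
        offspringPGF p₁ s =
          1 / (1 - P) * (offspringPGF p (P + s * (1 - P)) - offspringPGF p (s * (1 - P))) := by
  obtain ⟨X, hX, hiso⟩ := hT
  have htree : ∀ᵐ ω ∂μ, IsLocallyFiniteTree (X ω) := by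
    refine ae_of_ae_map hX.aemeasurable ?_
    rw [hX.map_eq]
    exact ae_isLocallyFiniteTree p
  have hnodraw : ∀ᵐ ω ∂μ, NoDraw (X ω) := by
    filter_upwards [hiso, htree, hdraw] with ω h1 h2 h3
    exact (isDrawFree_wordGraph_iff h2).1 (h1.isDrawFree h3)
  -- Draw-freeness passes from `Ω` to the canonical model because `NoDraw` is a measurable property
  -- of the set of words.
  have hd : ∀ᵐ ξ ∂familySizeLaw p, NoDraw (familyTree ξ) := by
    have := (ae_map_iff hX.aemeasurable measurableSet_noDraw).2 hnodraw
    rw [hX.map_eq] at this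
    exact ae_of_ae_map measurable_familyTree.aemeasurable this
  have hN : {ω | (T ω).root ∈ (T ω).nPositions} =ᵐ[μ] X ⁻¹' {t | Win t} := by
    filter_upwards [hiso, htree] with ω h1 h2
    exact propext (h1.root_mem_nPositions_iff.trans (nil_mem_nPositions_wordGraph_iff h2))
  have hL : {ω | (T ω).root ∈ (T ω).pPositions} =ᵐ[μ] X ⁻¹' {t | Win t}ᶜ := by
    filter_upwards [hiso, htree, hnodraw] with ω h1 h2 h3
    exact propext (h1.root_mem_pPositions_iff.trans (nil_mem_pPositions_wordGraph_iff h2 h3))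
  have hP' : P = (familySizeLaw p).real winSetᶜ := by
    rw [hP, measureReal_congr hL, ← map_measureReal_apply_of_aemeasurable hX.aemeasurable
      measurableSet_setOf_win.compl, hX.map_eq, galtonWatsonLaw,
      map_measureReal_apply measurable_familyTree measurableSet_setOf_win.compl]
    rfl
  have hcond := hX.cond measurableSet_setOf_win hN
  have hac := cond_absolutelyContinuous (μ := μ) (s := {ω | (T ω).root ∈ (T ω).nPositions})
  have hwin : ∀ᵐ ω ∂μ[|{ω | (T ω).root ∈ (T ω).nPositions}], Win (X ω) := by
    refine ae_of_ae_map hcond.aemeasurable ?_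
    rw [hcond.map_eq]
    exact ae_cond_mem measurableSet_setOf_win
  refine ⟨reducedOffspring hd hp, ⟨fun ω => reduce (X ω), ⟨?_, ?_⟩, ?_⟩,
    fun s hs => offspringPGF_reducedOffspring hd hp hP' hs⟩
  · exact measurable_reduce.comp_aemeasurable hcond.aemeasurable
  · rw [← map_reduce_cond_galtonWatsonLaw hd hp, ← hcond.map_eq,
      AEMeasurable.map_map_of_aemeasurable measurable_reduce.aemeasurable hcond.aemeasurable]
    rfl
  -- Properties holding almost surely under `μ` persist under conditioning; only `hwin` comes from
  -- the conditioning itself.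
  · filter_upwards [hac.ae_le hiso, hac.ae_le htree, hac.ae_le hnodraw, hwin] with ω h1 h2 h3 h4
    exact h1.reducedComponent.trans (isIso_wordGraph_reduce h2 h3 h4)
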